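/- Let $k$ be a field, let $n\ge 1$ and $d\ge 0$ be integers, and let $A=k[x_1,\dots,x_d]$. Let $g\in A$ be a weighted homogeneous polynomial whose degree is relatively prime to $n$; that is, there is an $\mathbb N$-grading on the $k$-algebra $A$ with $A_0=k$ for which $g$ is homogeneous of some degree $m$ with $\gcd(m,n)=1$. Assume that the hypersurface ring $$R=k[z,x_1,\dots,x_d]/(z^n-g)$$ is a normal domain, and let $g=h_1\cdots h_r$, where the $h_i\in A$ are irreducible polynomials. Let $\operatorname{Cl}(R)$ be the divisor class group of $R$, i.e. the free abelian group on the height one prime ideals of $R$ modulo the subgroup of principal divisors $\operatorname{div}(f)=\sum_P \operatorname{ord}_P(f)\,P$, $f\in\operatorname{Frac}(R)^\times$. Then $$\operatorname{Cl}(R)\cong(\mathbb Z/n\mathbb Z)^{r-1}$$ (for $r=0$, which can occur only when $n=1$, the right-hand side is read as $0$). Each ideal $(z,h_i)R$, $1\le i\le r$, is a prime ideal of height one, and the classes of $(z,h_1),\dots,(z,h_{r-1})$ generate $\operatorname{Cl}(R)$. If $n\ge 2$, they form a minimal generating set of $\operatorname{Cl}(R)$: no proper subfamily of these $r-1$ classes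 generates $\operatorname{Cl}(R)$. -/

import Mathlib

/-- The height-one prime ideals of `R`, i.e. the prime divisors of `Spec R`. -/
structure PrimeDivisor (R : Type*) [CommRing R] where
  /-- the underlying ideal -/
  asIdeal : Ideal R
  isPrime : asIdeal.IsPrime
  height_eq_one : asIdeal.height = 1

namespace PrimeDivisor

variable {R : Type*} [CommRing R]

instance (P : PrimeDivisor R) : P.asIdeal.IsPrime := P.isPrime

theorem ext_asIdeal {P Q : PrimeDivisor R} (h : P.asIdeal = Q.asIdeal) : P = Q := by
  cases P; cases Q; cases h; rfl

instance krullDimLE (P : PrimeDivisor R) :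
    Ring.KrullDimLE 1 (Localization.AtPrime P.asIdeal) := by
  rw [Ring.krullDimLE_iff,
    IsLocalization.AtPrime.ringKrullDim_eq_height P.asIdeal (Localization.AtPrime P.asIdeal),
    P.height_eq_one]
  rfl

/-- The order of vanishing of `a : R` along `P`: the length of `R_P / a R_P`. When `R` is a
Noetherian normal domain, `R_P` is a discrete valuation ring and this is the normalized
valuation of `a`. It is used for `a ≠ 0` only. -/
noncomputable def ord (P : PrimeDivisor R) (a : R) : ℕ :=
  (Ring.ord (Localization.AtPrime P.asIdeal)
    (algebraMap R (Localization.AtPrime P.asIdeal) a)).toNat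

variable [IsDomain R]

theorem algebraMap_mem_nonZeroDivisors (P : PrimeDivisor R) {a : R} (ha : a ≠ 0) :
    algebraMap R (Localization.AtPrime P.asIdeal) a ∈
      nonZeroDivisors (Localization.AtPrime P.asIdeal) := by
  apply mem_nonZeroDivisors_of_ne_zero
  rwa [Ne, IsLocalization.to_map_eq_zero_iff (M := P.asIdeal.primeCompl) _
    P.asIdeal.primeCompl_le_nonZeroDivisors]

variable [IsNoetherianRing R]

theorem ord_mul (P : PrimeDivisor R) {a b : R} (ha : a ≠ 0) (hb : b ≠ 0) :
    P.ord (a * b) = P.ord a + P.ord b := by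
  have ha' := P.algebraMap_mem_nonZeroDivisors ha
  have hb' := P.algebraMap_mem_nonZeroDivisors hb
  rw [ord, map_mul, Ring.ord_mul _ hb', ENat.toNat_add (Ring.ord_ne_top ha') (Ring.ord_ne_top hb')]
  rfl

/-- A nonzero element vanishes along finitely many prime divisors only. -/
theorem finite_ord_ne_zero {a : R} (ha : a ≠ 0) :
    {P : PrimeDivisor R | P.ord a ≠ 0}.Finite := by
  have hfin := Ideal.finite_minimalPrimes_of_isNoetherianRing R (Ideal.span {a})
  refine Set.Finite.of_finite_image (f := PrimeDivisor.asIdeal) (hfin.subset ?_)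
    (fun P _ Q _ h => ext_asIdeal h)
  rintro _ ⟨P, hP, rfl⟩
  have haP : a ∈ P.asIdeal := by
    by_contra h
    refine hP ?_
    have hu : IsUnit (algebraMap R (Localization.AtPrime P.asIdeal) a) :=
      IsLocalization.map_units _ (⟨a, h⟩ : P.asIdeal.primeCompl)
    simp [ord, Ring.ord_of_isUnit hu]
  refine ⟨⟨P.isPrime, (Ideal.span_singleton_le_iff_mem _).2 haP⟩, ?_⟩
  rintro Q ⟨hQ, haQ⟩ hQP
  by_contra hne
  have hlt : Q < P.asIdeal := lt_of_le_not_ge hQP hne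
  have h0 : Q.height = 0 := by
    have := Ideal.height_le_iff (p := P.asIdeal) (n := 1) |>.1 (by rw [P.height_eq_one]; rfl)
      Q hQ hlt
    simpa using this
  rw [Ideal.height_eq_zero_iff_eq_bot] at h0
  subst h0
  exact ha (by simpa using haQ)

end PrimeDivisor

section DivisorClassGroup

variable (R : Type*) [CommRing R] [IsDomain R] [IsNoetherianRing R]

/-- The group of Weil divisors of `R`: the free abelian group on the height-one primes. -/
abbrev WeilDivisor (R : Type*) [CommRing R] : Type _ := PrimeDivisor R →₀ ℤ

variable {R} in
/-- The divisor `∑ ord_P(a) P` of a nonzero element `a` of `R`. -/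
noncomputable def WeilDivisor.div (a : R) (ha : a ≠ 0) : WeilDivisor R :=
  Finsupp.ofSupportFinite (fun P => (P.ord a : ℤ))
    ((PrimeDivisor.finite_ord_ne_zero ha).subset fun P hP => by simpa using hP)

variable {R} in
theorem WeilDivisor.div_mul (a b : R) (ha : a ≠ 0) (hb : b ≠ 0) :
    WeilDivisor.div (a * b) (mul_ne_zero ha hb) = WeilDivisor.div a ha + WeilDivisor.div b hb := by
  ext P
  simp [WeilDivisor.div, Finsupp.ofSupportFinite_coe, P.ord_mul ha hb]

/-- The subgroup of principal divisors `div(a/b) = div(a) - div(b)`, where `a/b` runs through the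
nonzero elements of the fraction field of `R`. -/
def principalDivisors : AddSubgroup (WeilDivisor R) where
  carrier := {D | ∃ (a b : R) (ha : a ≠ 0) (hb : b ≠ 0),
    D = WeilDivisor.div a ha - WeilDivisor.div b hb}
  zero_mem' := ⟨1, 1, one_ne_zero, one_ne_zero, by simp⟩
  add_mem' := by
    rintro _ _ ⟨a, b, ha, hb, rfl⟩ ⟨c, d, hc, hd, rfl⟩
    refine ⟨a * c, b * d, mul_ne_zero ha hc, mul_ne_zero hb hd, ?_⟩
    rw [WeilDivisor.div_mul a c ha hc, WeilDivisor.div_mul b d hb hd]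
    abel
  neg_mem' := by
    rintro _ ⟨a, b, ha, hb, rfl⟩
    exact ⟨b, a, hb, ha, by abel⟩

/-- The divisor class group `Cl(R)`: Weil divisors modulo principal divisors. -/
abbrev DivisorClassGroup : Type _ := WeilDivisor R ⧸ principalDivisors R

variable {R} in
/-- The class in `Cl(R)` of a height-one prime. -/
noncomputable def PrimeDivisor.toClass (P : PrimeDivisor R) : DivisorClassGroup R :=
  QuotientAddGroup.mk (Finsupp.single P 1)

end DivisorClassGroup

/-- The ring `k[z, x₁, …, x_d] / (zⁿ - g)` with `g ∈ k[x₁, …, x_d]`, where `k[z, x₁, …, x_d]` is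
written as the polynomial ring in `z` over `k[x₁, …, x_d]`. -/
abbrev Hypersurface {k : Type*} [Field k] {d : ℕ} (n : ℕ) (g : MvPolynomial (Fin d) k) : Type _ :=
  Polynomial (MvPolynomial (Fin d) k) ⧸ Ideal.span {Polynomial.X ^ n - Polynomial.C g}

namespace Hypersurface

variable {k : Type*} [Field k] {d : ℕ} (n : ℕ) (g : MvPolynomial (Fin d) k)

/-- The image of `z` in `k[z, x₁, …, x_d] / (zⁿ - g)`. -/
noncomputable def z : Hypersurface n g :=
  Ideal.Quotient.mk _ Polynomial.X

/-- The natural ring homomorphism from `k[x₁, …, x_d]` to `k[z, x₁, …, x_d] / (zⁿ - g)`. -/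
noncomputable def of : MvPolynomial (Fin d) k →+* Hypersurface n g :=
  (Ideal.Quotient.mk _).comp Polynomial.C

end Hypersurface

/-!
Write `A = k[x₁, …, x_d]`. The ring `R` is free over `A` on `1, z, …, zⁿ⁻¹` and is graded by giving
`z` the degree `m` and multiplying the degrees on `A` by `n`. As `gcd(m, n) = 1`, the degree of a
homogeneous element of `R` determines the exponent of `z` modulo `n`, so every homogeneous element
has the form `a zʲ` with `a ∈ A`.

The class group of a graded domain is generated by the primes containing a nonzero homogeneous
element. Such a prime of `R` contains `z` or a homogeneous prime element `p` of `A`, and `p` stays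
prime in `R` unless it divides `g`; hence the `Pᵢ = (z, hᵢ)` generate. Since `div z = ∑ Pᵢ` and
`div hᵢ = n Pᵢ`, the class group is a quotient of `(ℤ/n)ʳ / (1, …, 1)`. There are no further
relations: if `∑ aᵢ Pᵢ = div u` with `aᵢ ≥ 0`, then `u` divides a power of `z`, so `u` is
homogeneous, `u = a zʲ`, and `aᵢ ≡ j` modulo `n` for all `i`.
-/

section PrimeDivisors

open IsLocalRing Ideal

theorem algebraMap_atPrime_dvd_iff {R : Type*} [CommRing R] [IsDomain R] (P : Ideal R) [P.IsPrime]
    {a b : R} : algebraMap R (Localization.AtPrime P) a ∣ algebraMap R (Localization.AtPrime P) b ↔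
      ∃ s ∉ P, a ∣ s * b := by
  constructor
  · rintro ⟨w, hw⟩
    obtain ⟨⟨x, s⟩, hxs⟩ := IsLocalization.surj P.primeCompl w
    refine ⟨s, s.2, x, IsLocalization.injective (Localization.AtPrime P)
      P.primeCompl_le_nonZeroDivisors ?_⟩
    rw [map_mul, map_mul, hw, ← hxs]
    ring
  · rintro ⟨s, hs, h⟩
    have hu : IsUnit (algebraMap R (Localization.AtPrime P) s) :=
      IsLocalization.map_units _ (⟨s, hs⟩ : P.primeCompl)
    have hd := map_dvd (algebraMap R (Localization.AtPrime P)) h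
    rwa [map_mul, hu.dvd_mul_left] at hd

theorem mul_mem_maximalIdeal_or_isPrincipal {L : Type*} [CommRing L] [IsDomain L] [IsLocalRing L]
    {a b : L} (hb : b ≠ 0) (h : ∀ x ∈ maximalIdeal L, a ∣ b * x) :
    (∀ x ∈ maximalIdeal L, ∃ y ∈ maximalIdeal L, b * x = a * y) ∨
      (maximalIdeal L).IsPrincipal := by
  rw [or_iff_not_imp_left]
  intro hnot
  push Not at hnot
  obtain ⟨c, hc, hcy⟩ := hnot
  obtain ⟨u, hu⟩ := h c hc
  have hunit : IsUnit u := by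
    by_contra hu'
    exact hcy u ((mem_maximalIdeal u).2 hu') hu
  refine ⟨c, le_antisymm (fun x hx => ?_) ((span_singleton_le_iff_mem _).2 hc)⟩
  obtain ⟨y, hy⟩ := h x hx
  have hux : u * x = y * c := mul_left_cancel₀ hb (by linear_combination u * hy - y * hu)
  exact mem_span_singleton.2 (hunit.dvd_mul_left.1 ⟨y, hux.trans (mul_comm y c)⟩)

theorem dvd_of_forall_mul_eq_mul {L : Type*} [CommRing L] [IsDomain L] [IsIntegrallyClosed L]
    {a b : L} {I : Ideal L} (hI : I ≠ ⊥) (hfg : I.FG) (ha : a ≠ 0)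
    (h : ∀ x ∈ I, ∃ y ∈ I, b * x = a * y) : a ∣ b := by
  let K := FractionRing L
  have ha' : algebraMap L K a ≠ 0 := IsFractionRing.to_map_eq_zero_iff.not.mpr ha
  obtain ⟨x, hxI, hx⟩ := (Submodule.ne_bot_iff I).1 hI
  have hint : IsIntegral L (algebraMap L K b / algebraMap L K a) := by
    refine isIntegral_of_smul_mem_submodule (Submodule.map (Algebra.linearMap L K) I)
      ((Submodule.ne_bot_iff _).2 ⟨_, ⟨x, hxI, rfl⟩, IsFractionRing.to_map_eq_zero_iff.not.mpr hx⟩)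
      (Submodule.FG.map _ hfg) _ ?_
    rintro _ ⟨x, hx, rfl⟩
    obtain ⟨y, hy, hxy⟩ := h x hx
    refine ⟨y, hy, ?_⟩
    rw [Algebra.linearMap_apply, Algebra.linearMap_apply, smul_eq_mul, div_mul_eq_mul_div,
      eq_div_iff ha', ← map_mul, ← map_mul, hxy, mul_comm]
  obtain ⟨y, hy⟩ := IsIntegrallyClosed.algebraMap_eq_of_integral hint
  refine ⟨y, IsFractionRing.injective L K ?_⟩
  rw [map_mul, hy, mul_div_cancel₀ _ ha']

/- If the fraction `b / a` maps the maximal ideal into itself, it is integral over `L`, hence in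
`L`; otherwise it maps some element `c` of the maximal ideal to a unit, and `c` is a generator. -/
theorem isPrincipal_maximalIdeal_of_dvd_mul {L : Type*} [CommRing L] [IsDomain L]
    [IsLocalRing L] [IsNoetherianRing L] [IsIntegrallyClosed L] {a b : L} (ha : a ≠ 0)
    (hab : ¬ a ∣ b) (h : ∀ x ∈ maximalIdeal L, a ∣ b * x) : (maximalIdeal L).IsPrincipal := by
  have hb : b ≠ 0 := by
    rintro rfl
    exact hab (dvd_zero a)
  rcases mul_mem_maximalIdeal_or_isPrincipal hb h with hstable | hprin
  swap; · exact hprin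
  by_contra hprin
  have hbot : maximalIdeal L ≠ ⊥ := fun hbot => hprin (hbot ▸ inferInstance)
  exact hab (dvd_of_forall_mul_eq_mul hbot (IsNoetherian.noetherian _) ha hstable)

theorem isPrincipal_maximalIdeal_atPrime {R : Type*} [CommRing R] [IsDomain R] [IsNoetherianRing R]
    [IsIntegrallyClosed R] {P : Ideal R} [P.IsPrime] {b c : R} (hb : b ≠ 0)
    (hP : ∀ u, u ∈ P ↔ b ∣ u * c) : (maximalIdeal (Localization.AtPrime P)).IsPrincipal := by
  let L := Localization.AtPrime P
  have : IsIntegrallyClosed L :=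
    isIntegrallyClosed_of_isLocalization L P.primeCompl P.primeCompl_le_nonZeroDivisors
  have : IsNoetherianRing L := IsLocalization.isNoetherianRing P.primeCompl L inferInstance
  have hinj : Function.Injective (algebraMap R L) :=
    IsLocalization.injective L P.primeCompl_le_nonZeroDivisors
  refine isPrincipal_maximalIdeal_of_dvd_mul ((map_ne_zero_iff _ hinj).2 hb)
    (b := algebraMap R L c) ?_ fun x hx => ?_
  · rw [algebraMap_atPrime_dvd_iff]
    rintro ⟨s, hs, hd⟩
    exact hs ((hP s).2 hd)
  · have hle : P * span {c} ≤ span {b} := by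
      refine mul_le.2 fun u hu v hv => ?_
      obtain ⟨w, rfl⟩ := mem_span_singleton.1 hv
      rw [← mul_assoc, mem_span_singleton]
      exact dvd_mul_of_dvd_left ((hP u).1 hu) w
    have hmap := map_mono (f := algebraMap R L) hle
    rw [Ideal.map_mul, Localization.AtPrime.map_eq_maximalIdeal, map_span, map_span,
      Set.image_singleton, Set.image_singleton] at hmap
    exact mem_span_singleton.1
      (mul_comm x _ ▸ hmap (mul_mem_mul hx (mem_span_singleton_self _)))

theorem height_le_one_of_isPrincipal_maximalIdeal {R : Type*} [CommRing R] {P : Ideal R}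
    [P.IsPrime] [IsNoetherianRing R] (h : (maximalIdeal (Localization.AtPrime P)).IsPrincipal) :
    P.height ≤ 1 := by
  have : IsNoetherianRing (Localization.AtPrime P) :=
    IsLocalization.isNoetherianRing P.primeCompl _ inferInstance
  have hle := height_le_one_of_isPrincipal_of_mem_minimalPrimes
    (maximalIdeal (Localization.AtPrime P)) (maximalIdeal (Localization.AtPrime P))
    (by rw [minimalPrimes_eq_subsingleton_self]; rfl)
  rwa [← IsLocalization.height_under P.primeCompl,
    Localization.AtPrime.under_maximalIdeal] at hle

theorem exists_associatedPrime_of_not_dvd {R : Type*} [CommRing R] [IsNoetherianRing R] {a b : R}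
    (h : ¬ b ∣ a) : ∃ P : Ideal R, P.IsPrime ∧ (∃ c, ∀ u, u ∈ P ↔ b ∣ u * c) ∧
      ∀ u, b ∣ u * a → u ∈ P := by
  have hcolon (u v : R) :
      u ∈ (⊥ : Submodule R (R ⧸ span {b})).colon {Ideal.Quotient.mk (span {b}) v} ↔
      b ∣ u * v := by
    rw [Submodule.mem_colon_singleton, Submodule.mem_bot, ← mem_span_singleton,
      ← Ideal.Quotient.eq_zero_iff_mem, map_mul]
    rfl
  have ha : Ideal.Quotient.mk (span {b}) a ≠ 0 := by
    rwa [Ne, Ideal.Quotient.eq_zero_iff_mem, mem_span_singleton]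
  obtain ⟨P, hP, haP⟩ := exists_le_isAssociatedPrime_of_isNoetherianRing R _ ha
  obtain ⟨hprime, y, hy⟩ := isAssociatedPrime_iff.1 hP
  obtain ⟨c, rfl⟩ := Ideal.Quotient.mk_surjective y
  exact ⟨P, hprime, ⟨c, fun u => by rw [hy, hcolon]⟩, fun u hu => haP ((hcolon u a).2 hu)⟩

namespace PrimeDivisor

variable {R : Type*} [CommRing R]

theorem ord_eq_zero_of_notMem {P : PrimeDivisor R} {a : R} (h : a ∉ P.asIdeal) : P.ord a = 0 := by
  have hu : IsUnit (algebraMap R (Localization.AtPrime P.asIdeal) a) :=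
    IsLocalization.map_units _ (⟨a, h⟩ : P.asIdeal.primeCompl)
  simp [ord, Ring.ord_of_isUnit hu]

variable [IsDomain R]

theorem ne_bot (P : PrimeDivisor R) : P.asIdeal ≠ ⊥ := by
  intro h
  have := P.height_eq_one
  rw [h, height_bot] at this
  exact zero_ne_one this

theorem eq_of_le {P : PrimeDivisor R} {I : Ideal R} [I.IsPrime] (hI : I ≠ ⊥)
    (h : I ≤ P.asIdeal) : I = P.asIdeal := by
  by_contra hne
  have hlt := (height_le_iff (p := P.asIdeal) (n := 1)).1 P.height_eq_one.le I inferInstance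
    (lt_of_le_of_ne h hne)
  exact hI (height_eq_zero_iff_eq_bot.1 (by simpa using hlt))

theorem ord_eq_one {P : PrimeDivisor R} {a : R} (ha : a ∈ P.asIdeal)
    (h : ∀ q ∈ P.asIdeal, ∃ s ∉ P.asIdeal, a ∣ s * q) : P.ord a = 1 := by
  let L := Localization.AtPrime P.asIdeal
  have hspan : span {algebraMap R L a} = maximalIdeal L := by
    rw [← Localization.AtPrime.map_eq_maximalIdeal]
    refine le_antisymm ((span_singleton_le_iff_mem _).2 (mem_map_of_mem _ ha))
      (map_le_iff_le_comap.2 fun q hq => ?_)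
    exact mem_span_singleton.2 ((algebraMap_atPrime_dvd_iff _).2 (h q hq))
  have hlength : Ring.ord L (algebraMap R L a) = 1 := by
    rw [Ring.ord, Module.length_eq_one_iff, hspan, isSimpleModule_iff_quot_maximal]
    exact ⟨_, inferInstance, ⟨LinearEquiv.refl _ _⟩⟩
  rw [ord, hlength, ENat.toNat_one]

theorem ord_pow (P : PrimeDivisor R) {a : R} (ha : a ≠ 0) (j : ℕ) :
    P.ord (a ^ j) = j * P.ord a := by
  rw [ord, map_pow, Ring.ord_pow (P.algebraMap_mem_nonZeroDivisors ha), nsmul_eq_mul,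
    ENat.toNat_mul, ENat.toNat_natCast, ord]

variable [IsNoetherianRing R]

theorem algebraMap_dvd_of_ord_le (P : PrimeDivisor R)
    [IsDiscreteValuationRing (Localization.AtPrime P.asIdeal)] {a b : R} (ha : a ≠ 0)
    (hb : b ≠ 0) (h : P.ord b ≤ P.ord a) :
    algebraMap R (Localization.AtPrime P.asIdeal) b ∣ algebraMap R _ a := by
  rw [← IsDiscreteValuationRing.addVal_le_iff_dvd, ← Ring.ord_eq_addVal, ← Ring.ord_eq_addVal]
  rw [← ENat.natCast_toNat (Ring.ord_ne_top (P.algebraMap_mem_nonZeroDivisors ha)),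
    ← ENat.natCast_toNat (Ring.ord_ne_top (P.algebraMap_mem_nonZeroDivisors hb))]
  exact Nat.cast_le.2 h

/- It suffices to test at the associated primes of `R / (b)`; by normality these have height one. -/
theorem dvd_of_forall_ord_le [IsIntegrallyClosed R] {a b : R} (ha : a ≠ 0) (hb : b ≠ 0)
    (h : ∀ P : PrimeDivisor R, P.ord b ≤ P.ord a) : b ∣ a := by
  by_contra hdvd
  obtain ⟨P, hP, ⟨c, hc⟩, haP⟩ := exists_associatedPrime_of_not_dvd hdvd
  have hbP : b ∈ P := (hc b).2 (dvd_mul_right b c)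
  have hbot : P ≠ ⊥ := by
    rintro rfl
    exact hb hbP
  have hprin := isPrincipal_maximalIdeal_atPrime hb hc
  have hheight : P.height = 1 :=
    le_antisymm (height_le_one_of_isPrincipal_maximalIdeal hprin)
      (Order.one_le_iff_ne_zero.2 (height_eq_zero_iff_eq_bot.not.2 hbot))
  have hfield : ¬ IsField (Localization.AtPrime P) :=
    IsLocalization.AtPrime.not_isField R hbot _
  have : IsNoetherianRing (Localization.AtPrime P) :=
    IsLocalization.isNoetherianRing P.primeCompl _ inferInstance
  let Q : PrimeDivisor R := ⟨P, hP, hheight⟩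
  have : IsDiscreteValuationRing (Localization.AtPrime Q.asIdeal) :=
    ((IsDiscreteValuationRing.TFAE _ hfield).out 0 4).2 hprin
  obtain ⟨s, hs, hd⟩ := (algebraMap_atPrime_dvd_iff P).1 (Q.algebraMap_dvd_of_ord_le ha hb (h Q))
  exact hs (haP s hd)

end PrimeDivisor

namespace WeilDivisor

variable {R : Type*} [CommRing R] [IsDomain R] [IsNoetherianRing R]

theorem div_apply (a : R) (ha : a ≠ 0) (P : PrimeDivisor R) : div a ha P = P.ord a := rfl

theorem mk_eq_sum (D : WeilDivisor R) :
    (QuotientAddGroup.mk D : DivisorClassGroup R) = D.sum fun P k => k • P.toClass := by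
  conv_lhs => rw [← Finsupp.sum_single D]
  rw [← QuotientAddGroup.mk'_apply, map_finsuppSum]
  refine Finsupp.sum_congr fun P _ => ?_
  rw [PrimeDivisor.toClass, ← QuotientAddGroup.mk_zsmul, Finsupp.smul_single_one]
  rfl

theorem mk_div (a : R) (ha : a ≠ 0) :
    (QuotientAddGroup.mk (div a ha) : DivisorClassGroup R) = 0 := by
  have hone : div (1 : R) one_ne_zero = 0 := by
    ext P
    rw [div_apply, PrimeDivisor.ord_eq_zero_of_notMem P.isPrime.one_notMem]
    rfl
  exact (QuotientAddGroup.eq_zero_iff _).2 ⟨a, 1, ha, one_ne_zero, by rw [hone, sub_zero]⟩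

theorem exists_div_eq_of_mk_eq_zero [IsIntegrallyClosed R] {D : WeilDivisor R} (hD : 0 ≤ D)
    (h : (QuotientAddGroup.mk D : DivisorClassGroup R) = 0) : ∃ u, ∃ hu : u ≠ 0, div u hu = D := by
  obtain ⟨a, b, ha, hb, rfl⟩ := (QuotientAddGroup.eq_zero_iff D).1 h
  obtain ⟨u, rfl⟩ : b ∣ a := PrimeDivisor.dvd_of_forall_ord_le ha hb fun P => by
    simpa [div_apply] using hD P
  exact ⟨u, right_ne_zero_of_mul ha, by rw [div_mul b u hb (right_ne_zero_of_mul ha)]; abel⟩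

end WeilDivisor

namespace PrimeDivisor

variable {R : Type*} [CommRing R] [IsDomain R] [IsNoetherianRing R]

theorem closure_range_toClass :
    AddSubgroup.closure (Set.range (toClass : PrimeDivisor R → DivisorClassGroup R)) = ⊤ := by
  refine eq_top_iff.2 fun x _ => ?_
  obtain ⟨D, rfl⟩ := QuotientAddGroup.mk_surjective x
  rw [WeilDivisor.mk_eq_sum]
  exact sum_mem fun P _ => zsmul_mem (AddSubgroup.subset_closure (Set.mem_range_self P)) _

theorem toClass_mem_of_ord_eq_one {S : AddSubgroup (DivisorClassGroup R)} {Q : PrimeDivisor R}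
    {f : R} (hf : f ≠ 0) (hQ : Q.ord f = 1) (h : ∀ P ≠ Q, f ∈ P.asIdeal → P.toClass ∈ S) :
    Q.toClass ∈ S := by
  classical
  have hsum := WeilDivisor.mk_div f hf
  rw [WeilDivisor.mk_eq_sum, ← Finsupp.add_sum_erase' _ Q _ fun P => zero_smul ℤ P.toClass,
    WeilDivisor.div_apply, hQ, Nat.cast_one, one_smul, add_eq_zero_iff_eq_neg] at hsum
  rw [hsum]
  refine neg_mem (sum_mem fun P hP => ?_)
  rw [Finsupp.support_erase, Finset.mem_erase, Finsupp.mem_support_iff, WeilDivisor.div_apply] at hP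
  refine zsmul_mem (h P hP.1 ?_) _
  by_contra hfP
  exact hP.2 (by rw [ord_eq_zero_of_notMem hfP, Nat.cast_zero])

theorem toClass_eq_zero_of_eq_span {P : PrimeDivisor R} {p : R} (hp : P.asIdeal = span {p}) :
    P.toClass = 0 := by
  have hp0 : p ≠ 0 := by
    rintro rfl
    exact P.ne_bot (by simpa using hp)
  have hord : P.ord p = 1 := ord_eq_one (hp ▸ mem_span_singleton_self p) fun q hq =>
    ⟨1, P.isPrime.one_notMem, by rwa [one_mul, ← mem_span_singleton, ← hp]⟩
  refine AddSubgroup.mem_bot.1 (toClass_mem_of_ord_eq_one hp0 hord fun Q hQP hpQ => ?_)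
  exact absurd (ext_asIdeal (eq_of_le P.ne_bot (hp ▸ (span_singleton_le_iff_mem _).2 hpQ))).symm hQP

variable {ι : Type*} [Fintype ι]
  {P : ι → PrimeDivisor R}

theorem sum_ord_smul_toClass_eq_zero (hP : Function.Injective P) {a : R} (ha : a ≠ 0)
    (h : ∀ Q : PrimeDivisor R, a ∈ Q.asIdeal → Q ∈ Set.range P) :
    ∑ i, (P i).ord a • (P i).toClass = 0 := by
  have hsupp : (WeilDivisor.div a ha).support ⊆ Finset.univ.map ⟨P, hP⟩ := by
    intro Q hQ
    rw [Finsupp.mem_support_iff, WeilDivisor.div_apply, Nat.cast_ne_zero] at hQ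
    obtain ⟨i, rfl⟩ := h Q (by_contra fun haQ => hQ (ord_eq_zero_of_notMem haQ))
    exact Finset.mem_map_of_mem ⟨P, hP⟩ (Finset.mem_univ i)
  rw [← WeilDivisor.mk_div a ha, WeilDivisor.mk_eq_sum,
    Finsupp.sum_of_support_subset _ hsupp _ fun Q _ => zero_smul ℤ Q.toClass, Finset.sum_map]
  exact Finset.sum_congr rfl fun i _ => (natCast_zsmul _ _).symm

theorem exists_ord_eq_of_sum_smul_toClass_eq_zero [IsIntegrallyClosed R]
    (hP : Function.Injective P) {c : ι → ℕ} (hc : ∑ i, c i • (P i).toClass = 0) :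
    ∃ u : R, u ≠ 0 ∧ (∀ i, (P i).ord u = c i) ∧ ∀ Q ∉ Set.range P, Q.ord u = 0 := by
  let D : WeilDivisor R := (Finsupp.equivFunOnFinite.symm fun i => (c i : ℤ)).mapDomain P
  have hDP (i : ι) : D (P i) = c i := Finsupp.mapDomain_apply hP _ i
  have hDQ (Q : PrimeDivisor R) (hQ : Q ∉ Set.range P) : D Q = 0 :=
    Finsupp.mapDomain_of_notMem_range _ Q hQ
  have hmk : (QuotientAddGroup.mk D : DivisorClassGroup R) = 0 := by
    rw [WeilDivisor.mk_eq_sum, Finsupp.sum_mapDomain_index_inj hP,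
      Finsupp.sum_fintype _ _ fun i => zero_smul ℤ (P i).toClass, ← hc]
    exact Finset.sum_congr rfl fun i _ => natCast_zsmul _ _
  have hD : 0 ≤ D := fun Q => by
    by_cases hQ : Q ∈ Set.range P
    · obtain ⟨i, rfl⟩ := hQ
      rw [hDP]
      exact Nat.cast_nonneg _
    · exact (hDQ Q hQ).ge
  obtain ⟨u, hu, hdiv⟩ := WeilDivisor.exists_div_eq_of_mk_eq_zero hD hmk
  have hord (Q : PrimeDivisor R) : (Q.ord u : ℤ) = D Q := by rw [← hdiv, WeilDivisor.div_apply]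
  exact ⟨u, hu, fun i => Nat.cast_injective ((hord _).trans (hDP i)),
    fun Q hQ => Nat.cast_injective ((hord Q).trans (hDQ Q hQ))⟩

end PrimeDivisor

end PrimeDivisors

section GradedDomain

open Polynomial DirectSum

theorem eq_monomial_of_natDegree_le_natTrailingDegree {R : Type*} [Semiring R] {F : R[X]}
    (h : F.natDegree ≤ F.natTrailingDegree) : F = monomial F.natDegree F.leadingCoeff := by
  ext j
  rw [coeff_monomial]
  split_ifs with hj
  · rw [← hj, Polynomial.leadingCoeff]
  · rcases lt_or_gt_of_ne hj with hlt | hgt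
    · exact coeff_eq_zero_of_natDegree_lt hlt
    · exact coeff_eq_zero_of_lt_natTrailingDegree (hgt.trans_le h)

theorem le_natTrailingDegree_of_X_pow_dvd {R : Type*} [Semiring R] {F : R[X]} {k : ℕ} (hF : F ≠ 0)
    (h : X ^ k ∣ F) : k ≤ F.natTrailingDegree :=
  le_natTrailingDegree hF (X_pow_dvd_iff.1 h)

theorem X_pow_dvd_monomial {R : Type*} [CommSemiring R] (k : ℕ) (a : R) :
    (X ^ k : R[X]) ∣ monomial k a :=
  C_mul_X_pow_eq_monomial (R := R) ▸ dvd_mul_left _ _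

theorem X_pow_natTrailingDegree_dvd {R : Type*} [Semiring R] (F : R[X]) :
    X ^ F.natTrailingDegree ∣ F :=
  X_pow_dvd_iff.2 fun _ => coeff_eq_zero_of_lt_natTrailingDegree

theorem natDegree_sub_natTrailingDegree_lt {R : Type*} [CommRing R] [IsDomain R] {F G : R[X]}
    (hF : F ≠ 0) (hG : G ≠ 0)
    (h : F.natDegree - F.natTrailingDegree ≤ G.natDegree - G.natTrailingDegree)
    (hne : monomial F.natDegree F.leadingCoeff * G ≠ monomial G.natDegree G.leadingCoeff * F) :
    let H := monomial F.natDegree F.leadingCoeff * G - monomial G.natDegree G.leadingCoeff * F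
    H.natDegree - H.natTrailingDegree < G.natDegree - G.natTrailingDegree := by
  intro H
  have hH : H ≠ 0 := sub_ne_zero.2 hne
  have hlead (P Q : R[X]) (hP : P ≠ 0) (hQ : Q ≠ 0) :
      (monomial P.natDegree P.leadingCoeff * Q).degree = (P.natDegree + Q.natDegree : ℕ) := by
    rw [degree_mul, degree_monomial _ (leadingCoeff_ne_zero.2 hP), degree_eq_natDegree hQ]
    rfl
  have hdegree : H.natDegree < F.natDegree + G.natDegree := by
    rw [natDegree_lt_iff_degree_lt hH, ← hlead F G hF hG]
    refine degree_sub_lt_left ?_ ?_ ?_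
    · rw [hlead F G hF hG, hlead G F hG hF, add_comm]
    · exact mul_ne_zero ((monomial_eq_zero_iff _ _).not.2 (leadingCoeff_ne_zero.2 hF)) hG
    · rw [leadingCoeff_mul, leadingCoeff_mul, leadingCoeff_monomial, leadingCoeff_monomial,
          mul_comm]
  have hFt := natTrailingDegree_le_natDegree F
  have hGt := natTrailingDegree_le_natDegree G
  have hHt := natTrailingDegree_le_natDegree H
  have htrailing : F.natDegree + G.natTrailingDegree ≤ H.natTrailingDegree := by
    refine le_natTrailingDegree_of_X_pow_dvd hH (dvd_sub ?_ ?_)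
    · rw [pow_add]
      exact mul_dvd_mul (X_pow_dvd_monomial _ _) (X_pow_natTrailingDegree_dvd G)
    · refine (pow_dvd_pow X (?_ : _ ≤ G.natDegree + F.natTrailingDegree)).trans ?_
      · omega
      · rw [pow_add]
        exact mul_dvd_mul (X_pow_dvd_monomial _ _) (X_pow_natTrailingDegree_dvd F)
  omega

variable {R σ : Type*} [CommRing R] [SetLike σ R] [AddSubmonoidClass σ R]
  (ℬ : ℕ → σ) [GradedRing ℬ]

/-- The ring homomorphism `∑ xᵢ ↦ ∑ xᵢ Tⁱ` from an `ℕ`-graded ring to polynomials over it, where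
`xᵢ` is the homogeneous component of degree `i`. -/
noncomputable def componentPolynomial : R →+* R[X] :=
  (DirectSum.toSemiring
    (fun i => ((monomial i).toAddMonoidHom : R →+ R[X]).comp (AddSubmonoidClass.subtype (ℬ i)))
    rfl (fun {i j} x y => (monomial_mul_monomial i j (x : R) (y : R)).symm)).comp
    (decomposeRingEquiv ℬ).toRingHom

theorem componentPolynomial_of_mem {i : ℕ} {x : R} (hx : x ∈ ℬ i) :
    componentPolynomial ℬ x = monomial i x := by
  lift x to ℬ i using hx
  have h : decomposeRingEquiv ℬ (x : R) = DirectSum.of (fun i => ℬ i) i x := decompose_coe ℬ x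
  simp only [componentPolynomial, RingHom.comp_apply, RingEquiv.toRingHom_eq_coe, RingHom.coe_coe,
    h]
  exact DirectSum.toSemiring_of (A := fun i => ℬ i) _ _ _ i x

theorem coeff_componentPolynomial (x : R) (i : ℕ) :
    (componentPolynomial ℬ x).coeff i = decompose ℬ x i := by
  induction x using DirectSum.Decomposition.inductionOn ℬ with
  | zero => simp
  | @homogeneous j y =>
    rw [componentPolynomial_of_mem ℬ y.2, coeff_monomial, decompose_coe, coe_of_apply]
    split_ifs <;> rfl
  | add a b ha hb => simp [ha, hb]

theorem coeff_componentPolynomial_mem (x : R) (i : ℕ) :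
    (componentPolynomial ℬ x).coeff i ∈ ℬ i := by
  rw [coeff_componentPolynomial]
  exact SetLike.coe_mem _

theorem componentPolynomial_injective : Function.Injective (componentPolynomial ℬ) := by
  intro x y h
  refine (decompose ℬ).injective (DFinsupp.ext fun i => Subtype.ext ?_)
  rw [← coeff_componentPolynomial, h, coeff_componentPolynomial]

theorem componentPolynomial_ne_zero {x : R} (hx : x ≠ 0) : componentPolynomial ℬ x ≠ 0 :=
  (map_ne_zero_iff _ (componentPolynomial_injective ℬ)).2 hx

theorem isHomogeneousElem_of_natDegree_le {x : R}
    (h : (componentPolynomial ℬ x).natDegree ≤ (componentPolynomial ℬ x).natTrailingDegree) :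
    SetLike.IsHomogeneousElem ℬ x := by
  have hmem := coeff_componentPolynomial_mem ℬ x (componentPolynomial ℬ x).natDegree
  have hx := componentPolynomial_injective ℬ
    ((eq_monomial_of_natDegree_le_natTrailingDegree h).trans
      (componentPolynomial_of_mem ℬ hmem).symm)
  exact ⟨(componentPolynomial ℬ x).natDegree, by rw [← hx] at hmem; exact hmem⟩

/-- The difference between the highest and the lowest degree of a nonzero homogeneous component;
it is the Euclidean function for the division modulo homogeneous factors. -/
noncomputable def componentWidth (x : R) : ℕ :=
  (componentPolynomial ℬ x).natDegree - (componentPolynomial ℬ x).natTrailingDegree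

variable [IsDomain R]

theorem isHomogeneousElem_of_dvd {x y : R} (hy : SetLike.IsHomogeneousElem ℬ y) (hy0 : y ≠ 0)
    (h : x ∣ y) : SetLike.IsHomogeneousElem ℬ x := by
  obtain ⟨w, rfl⟩ := h
  obtain ⟨D, hD⟩ := hy
  have hx0 := componentPolynomial_ne_zero ℬ (left_ne_zero_of_mul hy0)
  have hw0 := componentPolynomial_ne_zero ℬ (right_ne_zero_of_mul hy0)
  have hmul := componentPolynomial_of_mem ℬ hD
  rw [map_mul] at hmul
  have hdegree := congrArg natDegree hmul
  have htrailing := congrArg natTrailingDegree hmul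
  rw [natDegree_mul hx0 hw0, natDegree_monomial_eq _ hy0] at hdegree
  rw [natTrailingDegree_mul hx0 hw0, natTrailingDegree_monomial hy0] at htrailing
  have hw := natTrailingDegree_le_natDegree (componentPolynomial ℬ w)
  exact isHomogeneousElem_of_natDegree_le ℬ (by omega)

theorem exists_componentWidth_lt {f q : R} (hf : f ≠ 0) (hq : q ≠ 0)
    (h : componentWidth ℬ f ≤ componentWidth ℬ q) :
    ∃ a b : R, SetLike.IsHomogeneousElem ℬ b ∧ b ≠ 0 ∧
      (b * q = a * f ∨ componentWidth ℬ (b * q - a * f) < componentWidth ℬ q) := by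
  have hf' := componentPolynomial_ne_zero ℬ hf
  have hb := coeff_componentPolynomial_mem ℬ f (componentPolynomial ℬ f).natDegree
  have ha := coeff_componentPolynomial_mem ℬ q (componentPolynomial ℬ q).natDegree
  refine ⟨(componentPolynomial ℬ q).leadingCoeff, (componentPolynomial ℬ f).leadingCoeff, ⟨_, hb⟩,
    leadingCoeff_ne_zero.2 hf', or_iff_not_imp_left.2 fun hne => ?_⟩
  rw [coeff_natDegree] at hb ha
  rw [← (componentPolynomial_injective ℬ).eq_iff, map_mul, map_mul,
    componentPolynomial_of_mem ℬ hb, componentPolynomial_of_mem ℬ ha] at hne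
  have hlt := natDegree_sub_natTrailingDegree_lt hf' (componentPolynomial_ne_zero ℬ hq) h hne
  rwa [componentWidth, map_sub, map_mul, map_mul, componentPolynomial_of_mem ℬ hb,
    componentPolynomial_of_mem ℬ ha]

theorem exists_dvd_homogeneous_mul {I : Ideal R} (hI : I ≠ ⊥) :
    ∃ f ∈ I, f ≠ 0 ∧ ∀ q ∈ I, ∃ t : R, SetLike.IsHomogeneousElem ℬ t ∧ t ≠ 0 ∧ f ∣ t * q := by
  obtain ⟨f, ⟨hf, hf0⟩, hmin⟩ := WellFounded.has_min (measure (componentWidth ℬ)).wf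
    {f | f ∈ I ∧ f ≠ 0} ((Submodule.ne_bot_iff _).1 hI)
  refine ⟨f, hf, hf0, fun q hq => ?_⟩
  induction hw : componentWidth ℬ q using Nat.strong_induction_on generalizing q with
  | _ w ih =>
    by_cases hq0 : q = 0
    · exact ⟨1, ⟨0, SetLike.GradedOne.one_mem⟩, one_ne_zero, by simp [hq0]⟩
    obtain ⟨a, b, hb, hb0, hab | hlt⟩ :=
      exists_componentWidth_lt ℬ hf0 hq0 (not_lt.1 (hmin q ⟨hq, hq0⟩))
    · exact ⟨b, hb, hb0, a, by rw [hab, mul_comm]⟩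
    · obtain ⟨t, ht, ht0, hdvd⟩ := ih _ (hw ▸ hlt) _
        (I.sub_mem (I.mul_mem_left b hq) (I.mul_mem_left a hf)) rfl
      refine ⟨t * b, ht.mul hb, mul_ne_zero ht0 hb0, ?_⟩
      have hsplit : t * b * q = t * (b * q - a * f) + t * a * f := by ring
      exact hsplit ▸ dvd_add hdvd (dvd_mul_left _ _)

theorem toClass_mem_of_homogeneous_mem [IsNoetherianRing R] {S : AddSubgroup (DivisorClassGroup R)}
    (hS : ∀ P : PrimeDivisor R, (∃ t ∈ P.asIdeal, SetLike.IsHomogeneousElem ℬ t ∧ t ≠ 0) →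
      P.toClass ∈ S) (Q : PrimeDivisor R) : Q.toClass ∈ S := by
  by_cases hQ : ∃ t ∈ Q.asIdeal, SetLike.IsHomogeneousElem ℬ t ∧ t ≠ 0
  · exact hS Q hQ
  obtain ⟨f, hf, hf0, hgen⟩ := exists_dvd_homogeneous_mul ℬ Q.ne_bot
  have hord : Q.ord f = 1 := PrimeDivisor.ord_eq_one hf fun q hq => by
    obtain ⟨t, ht, ht0, hdvd⟩ := hgen q hq
    exact ⟨t, fun htQ => hQ ⟨t, htQ, ht, ht0⟩, hdvd⟩
  refine PrimeDivisor.toClass_mem_of_ord_eq_one hf0 hord fun P hPQ hfP => hS P ?_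
  by_contra hP
  refine hPQ (PrimeDivisor.ext_asIdeal (PrimeDivisor.eq_of_le Q.ne_bot fun q hq => ?_).symm)
  obtain ⟨t, ht, ht0, hdvd⟩ := hgen q hq
  exact (P.isPrime.mem_or_mem (Ideal.mem_of_dvd _ hdvd hfP)).resolve_left
    fun htP => hP ⟨t, htP, ht, ht0⟩

end GradedDomain

section WeightSpace

open Polynomial DirectSum

variable {R : Type*} [CommRing R] (ρ : R →+* R[X])

/-- The elements on which a ring homomorphism `ρ : R →+* R[X]` is multiplication by `Xⁱ`. If `ρ` is
a coaction of the multiplicative monoid, these are the homogeneous components of a grading of `R`;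
over a graded ring, `componentPolynomial` recovers the grading in this way. -/
noncomputable def weightSpace (i : ℕ) : AddSubgroup R :=
  AddMonoidHom.eqLocus (ρ : R →+ R[X]) (monomial i).toAddMonoidHom

variable {ρ}

theorem mem_weightSpace {i : ℕ} {x : R} : x ∈ weightSpace ρ i ↔ ρ x = monomial i x := Iff.rfl

variable (ρ)

instance weightSpace.gradedMonoid : SetLike.GradedMonoid (weightSpace ρ) where
  one_mem := mem_weightSpace.2 (map_one ρ)
  mul_mem i j x y hx hy := mem_weightSpace.2 <| by
    rw [map_mul, mem_weightSpace.1 hx, mem_weightSpace.1 hy, monomial_mul_monomial]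

theorem coeff_coeAddMonoidHom_weightSpace (y : ⨁ i, weightSpace ρ i) (i : ℕ) :
    (ρ (DirectSum.coeAddMonoidHom (weightSpace ρ) y)).coeff i = y i := by
  induction y using DirectSum.induction_on with
  | zero => simp
  | of j y =>
    rw [coeAddMonoidHom_of, mem_weightSpace.1 y.2, coeff_monomial, coe_of_apply]
    split_ifs <;> rfl
  | add y y' hy hy' => simp [hy, hy']

theorem coeAddMonoidHom_weightSpace_injective :
    Function.Injective (DirectSum.coeAddMonoidHom (weightSpace ρ)) := by
  intro y y' h
  refine DFinsupp.ext fun i => Subtype.ext ?_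
  rw [← coeff_coeAddMonoidHom_weightSpace, h, coeff_coeAddMonoidHom_weightSpace]

theorem coeAddMonoidHom_sum_coeff {x : R} (heval : (ρ x).eval 1 = x)
    (hcoeff : ∀ i, (ρ x).coeff i ∈ weightSpace ρ i) :
    DirectSum.coeAddMonoidHom (weightSpace ρ) (∑ i ∈ (ρ x).support,
      DirectSum.of (fun i => weightSpace ρ i) i ⟨(ρ x).coeff i, hcoeff i⟩) = x := by
  rw [map_sum]
  conv_rhs => rw [← heval, eval_eq_sum, Polynomial.sum_def]
  simp only [coeAddMonoidHom_of, one_pow, mul_one]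

/-- The grading by weight spaces of a ring with a coaction of the multiplicative monoid. -/
noncomputable abbrev weightSpace.gradedRing (heval : ∀ x, (ρ x).eval 1 = x)
    (hcoeff : ∀ x i, (ρ x).coeff i ∈ weightSpace ρ i) : GradedRing (weightSpace ρ) where
  decompose' x := ∑ i ∈ (ρ x).support, DirectSum.of (fun i => weightSpace ρ i) i ⟨_, hcoeff x i⟩
  left_inv x := coeAddMonoidHom_sum_coeff ρ (heval x) (hcoeff x)
  right_inv _ := coeAddMonoidHom_weightSpace_injective ρ
    (coeAddMonoidHom_sum_coeff ρ (heval _) (hcoeff _))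

end WeightSpace

open Polynomial in
/-- A presentation of the `A`-algebra `B` as `A[z] / (zⁿ - g)`, the class of `z` being the root. -/
abbrev CyclicCover {A : Type*} (B : Type*) [CommRing A] [CommRing B] [Algebra A B] (n : ℕ) (g : A) :
    Type _ :=
  IsAdjoinRootMonic B (X ^ n - C g)

namespace CyclicCover

open Polynomial

variable {A B : Type*} [CommRing A] [CommRing B] [Algebra A B] {n : ℕ} {g : A}
  (H : CyclicCover B n g)

include H in
theorem ne_zero [Nontrivial B] : n ≠ 0 := by
  rintro rfl
  have hdeg := H.deg_pos
  rw [pow_zero, ← C_1, ← C_sub, natDegree_C] at hdeg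
  exact hdeg.false

theorem root_pow : H.root ^ n = algebraMap A B g := by
  rw [← sub_eq_zero, ← H.aeval_root_self, map_sub, map_pow, aeval_X, aeval_C]

section Grading

variable {σ : Type*} [SetLike σ A] [AddSubmonoidClass σ A] {𝒜 : ℕ → σ} [GradedRing 𝒜] {m : ℕ}

theorem homogeneous_induction (𝒜 : ℕ → σ) [GradedRing 𝒜] [Nontrivial B] {motive : B → Prop} (x : B)
    (algebraMap_mul_root_pow : ∀ (j e : ℕ) (a : A), j < n → a ∈ 𝒜 e →
      motive (algebraMap A B a * H.root ^ j))
    (add : ∀ x y, motive x → motive y → motive (x + y)) : motive x := by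
  have : Nontrivial A := (algebraMap A B).domain_nontrivial
  have hzero : motive 0 := by
    simpa using algebraMap_mul_root_pow 0 0 0 (Nat.pos_of_ne_zero H.ne_zero) (zero_mem _)
  rw [← H.basis.sum_repr x]
  refine Finset.sum_induction _ _ add hzero fun j _ => ?_
  have hj : (j : ℕ) < n := j.2.trans_eq natDegree_X_pow_sub_C
  rw [H.basis_apply, Algebra.smul_def]
  induction H.basis.repr x j using DirectSum.Decomposition.inductionOn 𝒜 with
  | zero => simpa using hzero
  | homogeneous a => exact algebraMap_mul_root_pow j _ a hj a.2
  | add a b ha hb => simpa only [map_add, add_mul] using add _ _ ha hb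

/-- The coaction on `B` for which `a * H.root ^ j` is homogeneous of degree `n * e + m * j` when `a`
is homogeneous of degree `e`. -/
noncomputable def coaction (hg : g ∈ 𝒜 m) : B →+* B[X] :=
  H.lift ((mapRingHom (algebraMap A B)).comp
    ((expand A n : A[X] →+* A[X]).comp (componentPolynomial 𝒜))) (monomial m H.root) <| by
      simp [eval₂_sub, componentPolynomial_of_mem 𝒜 hg, monomial_pow, expand_monomial, H.root_pow]

theorem coaction_algebraMap_mul_root_pow (hg : g ∈ 𝒜 m) {a : A} {e : ℕ} (ha : a ∈ 𝒜 e) (j : ℕ) :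
    H.coaction hg (algebraMap A B a * H.root ^ j) =
      monomial (n * e + m * j) (algebraMap A B a * H.root ^ j) := by
  rw [coaction, map_mul, map_pow, IsAdjoinRoot.lift_algebraMap, IsAdjoinRoot.lift_root]
  simp [componentPolynomial_of_mem 𝒜 ha, expand_monomial, monomial_pow, monomial_mul_monomial,
    mul_comm e]

theorem algebraMap_mul_root_pow_mem (hg : g ∈ 𝒜 m) {a : A} {e : ℕ} (ha : a ∈ 𝒜 e) (j : ℕ) :
    algebraMap A B a * H.root ^ j ∈ weightSpace (H.coaction hg) (n * e + m * j) :=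
  H.coaction_algebraMap_mul_root_pow hg ha j

theorem algebraMap_mem (hg : g ∈ 𝒜 m) {a : A} {e : ℕ} (ha : a ∈ 𝒜 e) :
    algebraMap A B a ∈ weightSpace (H.coaction hg) (n * e) := by
  simpa using H.algebraMap_mul_root_pow_mem hg ha 0

theorem root_pow_mem (hg : g ∈ 𝒜 m) (j : ℕ) :
    H.root ^ j ∈ weightSpace (H.coaction hg) (m * j) := by
  simpa using H.algebraMap_mul_root_pow_mem hg (SetLike.GradedOne.one_mem (A := 𝒜)) j

variable [Nontrivial B]

theorem eval_one_coaction (hg : g ∈ 𝒜 m) (x : B) : (H.coaction hg x).eval 1 = x := by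
  induction x using H.homogeneous_induction 𝒜 with
  | algebraMap_mul_root_pow j e a _ ha =>
    rw [H.coaction_algebraMap_mul_root_pow hg ha, eval_monomial, one_pow, mul_one]
  | add x y hx hy => rw [map_add, eval_add, hx, hy]

theorem coeff_coaction_mem (hg : g ∈ 𝒜 m) (x : B) (l : ℕ) :
    (H.coaction hg x).coeff l ∈ weightSpace (H.coaction hg) l := by
  induction x using H.homogeneous_induction 𝒜 with
  | algebraMap_mul_root_pow j e a _ ha =>
    rw [H.coaction_algebraMap_mul_root_pow hg ha, coeff_monomial]
    split_ifs with hl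
    · exact hl ▸ H.algebraMap_mul_root_pow_mem hg ha j
    · exact zero_mem _
  | add x y hx hy =>
    rw [map_add, coeff_add]
    exact add_mem hx hy

noncomputable instance gradedRing (hg : g ∈ 𝒜 m) : GradedRing (weightSpace (H.coaction hg)) :=
  weightSpace.gradedRing _ (H.eval_one_coaction hg) (H.coeff_coaction_mem hg)

theorem exists_coeff_coaction_eq (hg : g ∈ 𝒜 m) (hmn : m.Coprime n) {j : ℕ} (hj : j < n) (e : ℕ)
    (x : B) :
    ∃ a ∈ 𝒜 e, (H.coaction hg x).coeff (n * e + m * j) = algebraMap A B a * H.root ^ j := by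
  induction x using H.homogeneous_induction 𝒜 with
  | algebraMap_mul_root_pow j' e' a hj' ha =>
    rw [H.coaction_algebraMap_mul_root_pow hg ha, coeff_monomial]
    split_ifs with hdegree
    · have hmod : m * j' ≡ m * j [MOD n] := by
        simpa only [Nat.mul_add_mod, Nat.ModEq] using congrArg (· % n) hdegree
      obtain rfl := (hmod.cancel_left_of_coprime hmn.symm).eq_of_lt_of_lt hj' hj
      obtain rfl : e' = e := Nat.eq_of_mul_eq_mul_left (Nat.pos_of_ne_zero H.ne_zero)
        (Nat.add_right_cancel hdegree)
      exact ⟨a, ha, rfl⟩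
    · exact ⟨0, zero_mem _, by simp⟩
  | add x y hx hy =>
    obtain ⟨a, ha, hax⟩ := hx
    obtain ⟨b, hb, hby⟩ := hy
    exact ⟨a + b, add_mem ha hb, by rw [map_add, coeff_add, hax, hby, map_add, add_mul]⟩

theorem coeff_coaction_eq_zero (hg : g ∈ 𝒜 m) {l : ℕ} (hl : ∀ j < n, ∀ e, n * e + m * j ≠ l)
    (x : B) : (H.coaction hg x).coeff l = 0 := by
  induction x using H.homogeneous_induction 𝒜 with
  | algebraMap_mul_root_pow j e a hj ha =>
    rw [H.coaction_algebraMap_mul_root_pow hg ha, coeff_monomial, if_neg (hl j hj e)]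
  | add x y hx hy => rw [map_add, coeff_add, hx, hy, add_zero]

theorem exists_eq_algebraMap_mul_root_pow (hg : g ∈ 𝒜 m) (hmn : m.Coprime n) {x : B}
    (hx : SetLike.IsHomogeneousElem (weightSpace (H.coaction hg)) x) :
    ∃ (a : A) (j : ℕ), SetLike.IsHomogeneousElem 𝒜 a ∧ x = algebraMap A B a * H.root ^ j := by
  obtain ⟨l, hl⟩ := hx
  have hxl : (H.coaction hg x).coeff l = x := by
    rw [mem_weightSpace.1 hl, coeff_monomial_same]
  by_cases hdegree : ∃ j < n, ∃ e, n * e + m * j = l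
  · obtain ⟨j, hj, e, rfl⟩ := hdegree
    obtain ⟨a, ha, hax⟩ := H.exists_coeff_coaction_eq hg hmn hj e x
    exact ⟨a, j, ⟨e, ha⟩, hxl.symm.trans hax⟩
  · push Not at hdegree
    refine ⟨0, 0, ⟨0, zero_mem _⟩, ?_⟩
    rw [← hxl, H.coeff_coaction_eq_zero hg hdegree, map_zero, zero_mul]

end Grading

end CyclicCover

theorem exists_prime_dvd_mem {A : Type*} [CommRing A] [UniqueFactorizationMonoid A]
    {I : Ideal A} [I.IsPrime] {a : A} (ha : a ≠ 0) (haI : a ∈ I) : ∃ p ∈ I, Prime p ∧ p ∣ a := by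
  obtain ⟨f, hf, hfa⟩ := UniqueFactorizationMonoid.exists_prime_factors a ha
  obtain ⟨p, hpf, hpI⟩ := (Ideal.IsPrime.multiset_prod_mem_iff_exists_mem inferInstance f).1
    (Ideal.mem_of_dvd I hfa.symm.dvd haI)
  exact ⟨p, hpI, hf p hpf, (Multiset.dvd_prod hpf).trans hfa.dvd⟩

namespace CyclicCover

open Polynomial

variable {A B : Type*} [CommRing A] [CommRing B] [Algebra A B] {n : ℕ} {g : A}
  (H : CyclicCover B n g)

theorem exists_eq_algebraMap_add_mul_root (x : B) :
    ∃ (a : A) (y : B), x = algebraMap A B a + y * H.root := by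
  obtain ⟨F, rfl⟩ := H.map_surjective x
  refine ⟨F.coeff 0, H.map F.divX, ?_⟩
  conv_lhs => rw [← divX_mul_X_add F, map_add, map_mul, H.map_X, ← H.algebraMap_apply, add_comm]

theorem root_mem_of_dvd {p : A} (hpg : p ∣ g) {Q : Ideal B} [Q.IsPrime]
    (hpQ : algebraMap A B p ∈ Q) : H.root ∈ Q := by
  refine Ideal.IsPrime.mem_of_pow_mem inferInstance n ?_
  rw [H.root_pow]
  exact Ideal.mem_of_dvd _ (map_dvd _ hpg) hpQ

section Arithmetic

variable [Nontrivial B]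

include H

theorem algebraMap_dvd_algebraMap {a b : A} : algebraMap A B a ∣ algebraMap A B b ↔ a ∣ b := by
  refine ⟨?_, map_dvd (algebraMap A B)⟩
  rintro ⟨y, hy⟩
  have hcoeff := congrFun (congrArg H.coeff hy) 0
  rw [H.coeff_algebraMap, ← Algebra.smul_def, map_smul, Pi.single_eq_same] at hcoeff
  exact ⟨H.coeff y 0, hcoeff⟩

theorem algebraMap_ne_zero {a : A} (ha : a ≠ 0) : algebraMap A B a ≠ 0 := by
  rwa [Ne, ← zero_dvd_iff, ← map_zero (algebraMap A B), H.algebraMap_dvd_algebraMap, zero_dvd_iff]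

theorem root_ne_zero (hg0 : g ≠ 0) : H.root ≠ 0 := by
  intro hroot
  apply H.algebraMap_ne_zero hg0
  rw [← H.root_pow, hroot, zero_pow H.ne_zero]

theorem isUnit_of_algebraMap_dvd_root_pow {a : A} {j : ℕ} (hj : j < n)
    (h : algebraMap A B a ∣ H.root ^ j) : IsUnit a := by
  have : Nontrivial A := (algebraMap A B).domain_nontrivial
  obtain ⟨y, hy⟩ := h
  have hcoeff := congrFun (congrArg H.coeff hy) j
  rw [H.coeff_root_pow (hj.trans_eq natDegree_X_pow_sub_C.symm), ← Algebra.smul_def, map_smul,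
    Pi.single_eq_same] at hcoeff
  exact IsUnit.of_mul_eq_one _ hcoeff.symm

theorem dvd_of_algebraMap_dvd_mul_root_pow {p a : A} (hp : Prime p) (hpg : ¬ p ∣ g) {j : ℕ}
    (h : algebraMap A B p ∣ algebraMap A B a * H.root ^ j) : p ∣ a := by
  have hdvd : algebraMap A B p ∣ algebraMap A B (a * g ^ j) := by
    rw [map_mul, map_pow, ← H.root_pow, ← pow_mul, mul_comm n, pow_mul]
    exact h.trans (mul_dvd_mul_left _ (dvd_pow_self _ H.ne_zero))
  exact (hp.dvd_or_dvd (H.algebraMap_dvd_algebraMap.1 hdvd)).resolve_right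
    fun hpj => hpg (hp.dvd_of_dvd_pow hpj)

end Arithmetic

/- If `p ^ 2 ∣ g`, then `p ^ n ∣ (z ^ (n - 1)) ^ n`, so normality gives `p ∣ z ^ (n - 1)`. -/
include H in
theorem squarefree [IsDomain B] [IsIntegrallyClosed B] (hn : 2 ≤ n) : Squarefree g := by
  intro p hp
  refine H.isUnit_of_algebraMap_dvd_root_pow (j := n - 1) (by omega) ?_
  rw [← IsIntegrallyClosed.pow_dvd_pow_iff H.ne_zero, ← pow_mul, mul_comm, pow_mul, H.root_pow,
    ← map_pow, ← map_pow]
  refine map_dvd _ ((pow_dvd_pow p (?_ : n ≤ 2 * (n - 1))).trans ?_)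
  · omega
  · rw [pow_mul, pow_two]
    exact pow_dvd_pow_of_dvd hp (n - 1)

section SpanRoot

variable [Nontrivial B] {p : A} (hpg : p ∣ g)

/-- The reduction `B → A / (p)` sending the root to zero, for a divisor `p` of `g`. -/
noncomputable def residue : B →+* A ⧸ Ideal.span {p} :=
  H.lift (Ideal.Quotient.mk _) 0 <| by
    rw [eval₂_sub, eval₂_X_pow, eval₂_C, zero_pow H.ne_zero, zero_sub, neg_eq_zero,
      Ideal.Quotient.eq_zero_iff_mem, Ideal.mem_span_singleton]
    exact hpg

theorem residue_root : H.residue hpg H.root = 0 :=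
  IsAdjoinRoot.lift_root _ _

theorem residue_algebraMap_eq_zero {a : A} : H.residue hpg (algebraMap A B a) = 0 ↔ p ∣ a := by
  rw [residue, IsAdjoinRoot.lift_algebraMap, Ideal.Quotient.eq_zero_iff_mem,
    Ideal.mem_span_singleton]

theorem ker_residue :
    RingHom.ker (H.residue hpg) = Ideal.span {H.root, algebraMap A B p} := by
  refine le_antisymm (fun x hx => ?_) (Ideal.span_le.2 ?_)
  · obtain ⟨a, y, rfl⟩ := H.exists_eq_algebraMap_add_mul_root x
    rw [RingHom.mem_ker, map_add, map_mul, residue_root, mul_zero, add_zero,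
      residue_algebraMap_eq_zero] at hx
    obtain ⟨b, rfl⟩ := hx
    exact Ideal.mem_span_pair.2 ⟨y, algebraMap A B b, by rw [map_mul]; ring⟩
  · rintro _ (rfl | rfl)
    exacts [H.residue_root hpg, (H.residue_algebraMap_eq_zero hpg).2 dvd_rfl]

include hpg in
theorem algebraMap_mem_span_root_iff {a : A} :
    algebraMap A B a ∈ Ideal.span {H.root, algebraMap A B p} ↔ p ∣ a := by
  rw [← H.ker_residue hpg, RingHom.mem_ker, residue_algebraMap_eq_zero]

include hpg in
theorem isPrime_span_root (hp : Prime p) : (Ideal.span {H.root, algebraMap A B p}).IsPrime := by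
  rw [← H.ker_residue hpg]
  have : (Ideal.span {p}).IsPrime := (Ideal.span_singleton_prime hp.ne_zero).2 hp
  exact RingHom.ker_isPrime _

theorem exists_span_root_le [UniqueFactorizationMonoid A] (hg0 : g ≠ 0) {Q : Ideal B}
    [Q.IsPrime] (hQ : H.root ∈ Q) :
    ∃ p, Prime p ∧ p ∣ g ∧ Ideal.span {H.root, algebraMap A B p} ≤ Q := by
  have hgQ : g ∈ Q.comap (algebraMap A B) := by
    rw [Ideal.mem_comap, ← H.root_pow]
    exact Ideal.pow_mem_of_mem _ hQ _ (Nat.pos_of_ne_zero H.ne_zero)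
  obtain ⟨p, hpQ, hp, hpg⟩ := exists_prime_dvd_mem hg0 hgQ
  exact ⟨p, hp, hpg, Ideal.span_le.2 (Set.pair_subset hQ hpQ)⟩

end SpanRoot

end CyclicCover

namespace CyclicCover

open Polynomial

section RootDivisor

variable {A B : Type*} [CommRing A] [UniqueFactorizationMonoid A] [CommRing B]
  [IsDomain B] [IsNoetherianRing B] [Algebra A B] {n : ℕ} {g p : A} (H : CyclicCover B n g)
  (hg0 : g ≠ 0) (hp : Prime p) (hpg : p ∣ g)

/-- The prime divisor `(z, p)` of `A[z] / (zⁿ - g)` for a prime divisor `p` of `g`. -/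
noncomputable def rootDivisor : PrimeDivisor B where
  asIdeal := Ideal.span {H.root, algebraMap A B p}
  isPrime := H.isPrime_span_root hpg hp
  height_eq_one := by
    have hprime := H.isPrime_span_root hpg hp
    have hroot : H.root ∈ Ideal.span {H.root, algebraMap A B p} :=
      Ideal.subset_span (Set.mem_insert _ _)
    refine le_antisymm (Ideal.height_le_one_of_isPrincipal_of_mem_minimalPrimes
      (Ideal.span {H.root}) _ ⟨⟨hprime, (Ideal.span_singleton_le_iff_mem _).2 hroot⟩, ?_⟩) ?_
    · rintro Q ⟨hQ, hrootQ⟩ hQP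
      obtain ⟨q, hq, -, hle⟩ := H.exists_span_root_le hg0
        ((Ideal.span_singleton_le_iff_mem _).1 hrootQ)
      obtain ⟨hrootQ, hqQ⟩ := Set.pair_subset_iff.1 (Ideal.span_le.1 hle)
      have hpq : p ∣ q := (H.algebraMap_mem_span_root_iff hpg).1 (hQP hqQ)
      have hqp : q ∣ p := (hp.associated_of_dvd hq hpq).symm.dvd
      exact Ideal.span_le.2
        (Set.pair_subset hrootQ (Ideal.mem_of_dvd _ (_root_.map_dvd _ hqp) hqQ))
    · rw [Order.one_le_iff_ne_zero, Ne, Ideal.height_eq_zero_iff_eq_bot]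
      intro hbot
      exact H.root_ne_zero hg0 ((Submodule.mem_bot B).1 (hbot ▸ hroot))

theorem root_mem_rootDivisor : H.root ∈ (H.rootDivisor hg0 hp hpg).asIdeal :=
  Ideal.subset_span (Set.mem_insert _ _)

theorem algebraMap_mem_rootDivisor {a : A} :
    algebraMap A B a ∈ (H.rootDivisor hg0 hp hpg).asIdeal ↔ p ∣ a :=
  H.algebraMap_mem_span_root_iff hpg

theorem eq_rootDivisor {Q : PrimeDivisor B} (hpQ : algebraMap A B p ∈ Q.asIdeal) :
    Q = H.rootDivisor hg0 hp hpg := by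
  refine (PrimeDivisor.ext_asIdeal (PrimeDivisor.eq_of_le (PrimeDivisor.ne_bot _) ?_)).symm
  exact Ideal.span_le.2 (Set.pair_subset (H.root_mem_of_dvd hpg hpQ) hpQ)

variable (hsq : Squarefree g)

include hsq in
theorem ord_root_rootDivisor : (H.rootDivisor hg0 hp hpg).ord H.root = 1 := by
  obtain ⟨c, hc⟩ := id hpg
  have hroot : H.root ^ n = algebraMap A B p * algebraMap A B c := by
    rw [H.root_pow, ← map_mul, ← hc]
  refine PrimeDivisor.ord_eq_one (H.root_mem_rootDivisor hg0 hp hpg) fun q hq =>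
    ⟨algebraMap A B c, ?_, ?_⟩
  · rw [algebraMap_mem_rootDivisor]
    exact fun hpc => hp.not_isUnit (hsq p (hc ▸ mul_dvd_mul_left p hpc))
  · obtain ⟨x, y, rfl⟩ := Ideal.mem_span_pair.1 hq
    have hmul : algebraMap A B c * (x * H.root + y * algebraMap A B p) =
        algebraMap A B c * x * H.root + y * H.root ^ n := by
      rw [hroot]
      ring
    exact hmul ▸ dvd_add (dvd_mul_left _ _) ((dvd_pow_self _ H.ne_zero).mul_left _)

include hsq in
theorem ord_algebraMap_self_rootDivisor :
    (H.rootDivisor hg0 hp hpg).ord (algebraMap A B p) = n := by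
  have hord := (H.rootDivisor hg0 hp hpg).ord_pow (H.root_ne_zero hg0) n
  rw [H.root_pow, H.ord_root_rootDivisor hg0 hp hpg hsq, mul_one] at hord
  obtain ⟨c, rfl⟩ := id hpg
  have hc : algebraMap A B c ∉ (H.rootDivisor hg0 hp hpg).asIdeal := by
    rw [algebraMap_mem_rootDivisor]
    exact fun hpc => hp.not_isUnit (hsq p (mul_dvd_mul_left p hpc))
  rwa [map_mul, PrimeDivisor.ord_mul _ (H.algebraMap_ne_zero hp.ne_zero)
    (H.algebraMap_ne_zero (right_ne_zero_of_mul hg0)), PrimeDivisor.ord_eq_zero_of_notMem hc,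
    add_zero] at hord

include hsq in
theorem dvd_ord_algebraMap_rootDivisor {a : A} (ha : a ≠ 0) :
    n ∣ (H.rootDivisor hg0 hp hpg).ord (algebraMap A B a) := by
  obtain ⟨e, c, hpc, rfl⟩ := WfDvdMonoid.max_power_factor ha hp.irreducible
  have hp0 := H.algebraMap_ne_zero hp.ne_zero
  rw [← H.algebraMap_mem_rootDivisor hg0 hp hpg] at hpc
  rw [map_mul, map_pow, PrimeDivisor.ord_mul _ (pow_ne_zero _ hp0)
    (H.algebraMap_ne_zero (right_ne_zero_of_mul ha)), PrimeDivisor.ord_eq_zero_of_notMem hpc,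
    PrimeDivisor.ord_pow _ hp0, H.ord_algebraMap_self_rootDivisor hg0 hp hpg hsq, add_zero]
  exact dvd_mul_left _ _

end RootDivisor

section Homogeneous

variable {A B σ : Type*} [CommRing A] [CommRing B] [IsDomain B] [Algebra A B]
  {n : ℕ} {g : A} (H : CyclicCover B n g)
  [SetLike σ A] [AddSubmonoidClass σ A] {𝒜 : ℕ → σ} [GradedRing 𝒜] {m : ℕ}

include H

theorem isPrime_span_algebraMap (hg : g ∈ 𝒜 m) (hmn : m.Coprime n) {p : A} (hp : Prime p)
    (hpg : ¬ p ∣ g) (hph : SetLike.IsHomogeneousElem 𝒜 p) :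
    (Ideal.span {algebraMap A B p}).IsPrime := by
  have hhom : (Ideal.span {algebraMap A B p}).IsHomogeneous (weightSpace (H.coaction hg)) := by
    refine Ideal.homogeneous_span _ _ ?_
    rintro _ rfl
    obtain ⟨e, he⟩ := hph
    exact ⟨_, H.algebraMap_mem hg he⟩
  refine hhom.isPrime_of_homogeneous_mem_or_mem ?_ fun {x y} hx hy hxy => ?_
  · rw [Ne, Ideal.span_singleton_eq_top]
    intro hunit
    exact hp.not_dvd_one (H.dvd_of_algebraMap_dvd_mul_root_pow hp hpg (j := 0) hunit.dvd)
  · obtain ⟨a, i, -, rfl⟩ := H.exists_eq_algebraMap_mul_root_pow hg hmn hx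
    obtain ⟨b, j, -, rfl⟩ := H.exists_eq_algebraMap_mul_root_pow hg hmn hy
    rw [mul_mul_mul_comm, ← map_mul, ← pow_add, Ideal.mem_span_singleton] at hxy
    refine (hp.dvd_or_dvd (H.dvd_of_algebraMap_dvd_mul_root_pow hp hpg hxy)).imp ?_ ?_ <;>
      exact fun h => Ideal.mem_span_singleton.2 ((_root_.map_dvd _ h).mul_right _)

variable [IsDomain A] [UniqueFactorizationMonoid A] [IsNoetherianRing B]

theorem eq_top_of_forall_root_mem (hg : g ∈ 𝒜 m) (hmn : m.Coprime n)
    {S : AddSubgroup (DivisorClassGroup B)}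
    (hS : ∀ Q : PrimeDivisor B, H.root ∈ Q.asIdeal → Q.toClass ∈ S) : S = ⊤ := by
  rw [eq_top_iff, ← PrimeDivisor.closure_range_toClass, AddSubgroup.closure_le]
  rintro _ ⟨Q, rfl⟩
  refine toClass_mem_of_homogeneous_mem (weightSpace (H.coaction hg)) ?_ Q
  rintro P ⟨t, htP, ht, ht0⟩
  obtain ⟨a, j, ha, rfl⟩ := H.exists_eq_algebraMap_mul_root_pow hg hmn ht
  have ha0 : a ≠ 0 := by
    rintro rfl
    simp at ht0
  rcases P.isPrime.mem_or_mem htP with haP | hrootP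
  · obtain ⟨p, hpP, hp, hpa⟩ := exists_prime_dvd_mem ha0 (I := P.asIdeal.comap (algebraMap A B)) haP
    by_cases hpg : p ∣ g
    · exact hS P (H.root_mem_of_dvd hpg hpP)
    · have hprime := H.isPrime_span_algebraMap hg hmn hp hpg (isHomogeneousElem_of_dvd 𝒜 ha ha0 hpa)
      have hP : Ideal.span {algebraMap A B p} = P.asIdeal :=
        PrimeDivisor.eq_of_le (Ideal.span_singleton_eq_bot.not.2 (H.algebraMap_ne_zero hp.ne_zero))
          ((Ideal.span_singleton_le_iff_mem _).2 hpP)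
      exact PrimeDivisor.toClass_eq_zero_of_eq_span hP.symm ▸ zero_mem S
  · exact hS P (P.isPrime.mem_of_pow_mem j hrootP)

end Homogeneous

variable {A B σ ι : Type*} [CommRing A] [UniqueFactorizationMonoid A] [CommRing B]
  [IsDomain B] [IsNoetherianRing B] [Algebra A B] {n m : ℕ}
  [SetLike σ A] [AddSubmonoidClass σ A] {𝒜 : ℕ → σ} [GradedRing 𝒜]

section Torsion

variable [IsIntegrallyClosed B] {g : A} (H : CyclicCover B n g) (hg0 : g ≠ 0)

theorem nsmul_toClass_rootDivisor {p : A} (hp : Prime p) (hpg : p ∣ g) :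
    n • (H.rootDivisor hg0 hp hpg).toClass = 0 := by
  obtain rfl | hn : n = 1 ∨ 2 ≤ n := by have := H.ne_zero; omega
  · have hroot : H.root ∈ Ideal.span {algebraMap A B p} := by
      rw [← pow_one H.root, H.root_pow, Ideal.mem_span_singleton]
      exact _root_.map_dvd _ hpg
    rw [one_smul]
    refine PrimeDivisor.toClass_eq_zero_of_eq_span (p := algebraMap A B p) (le_antisymm ?_ ?_)
    · exact Ideal.span_le.2 (Set.pair_subset hroot (Ideal.mem_span_singleton_self _))
    · exact Ideal.span_mono (Set.subset_insert _ _)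
  · have hsum := PrimeDivisor.sum_ord_smul_toClass_eq_zero
      (P := fun _ : Unit => H.rootDivisor hg0 hp hpg) (Function.injective_of_subsingleton _)
      (H.algebraMap_ne_zero hp.ne_zero) fun Q hQ => ⟨(), (H.eq_rootDivisor hg0 hp hpg hQ).symm⟩
    rwa [Fintype.sum_unique, H.ord_algebraMap_self_rootDivisor hg0 hp hpg (H.squarefree hn)] at hsum

include H hg0 in
theorem nsmul_divisorClassGroup [IsDomain A] (hg : g ∈ 𝒜 m) (hmn : m.Coprime n)
    (x : DivisorClassGroup B) : n • x = 0 := by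
  have hker := H.eq_top_of_forall_root_mem hg hmn (S := (nsmulAddMonoidHom n).ker) fun Q hQ => by
    obtain ⟨p, hp, hpg, hle⟩ := H.exists_span_root_le hg0 hQ
    rw [H.eq_rootDivisor hg0 hp hpg (hle (Ideal.subset_span (Set.mem_insert_of_mem _ rfl)))]
    exact H.nsmul_toClass_rootDivisor hg0 hp hpg
  exact (AddSubgroup.eq_top_iff' _).1 hker x

end Torsion

section FactorDivisor

variable [IsDomain A] [Fintype ι] {h : ι → A} (H : CyclicCover B n (∏ i, h i))
  (hp : ∀ i, Prime (h i))

/-- The family of prime divisors `(z, hᵢ)` of `A[z] / (zⁿ - ∏ hᵢ)` for prime elements `hᵢ`. -/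
noncomputable def factorDivisor (i : ι) : PrimeDivisor B :=
  H.rootDivisor (Finset.prod_ne_zero_iff.2 fun i _ => (hp i).ne_zero) (hp i)
    (Finset.dvd_prod_of_mem h (Finset.mem_univ i))

theorem algebraMap_mem_factorDivisor {i : ι} {a : A} :
    algebraMap A B a ∈ (H.factorDivisor hp i).asIdeal ↔ h i ∣ a :=
  H.algebraMap_mem_rootDivisor _ (hp i) _

theorem mem_range_factorDivisor {Q : PrimeDivisor B} (hQ : H.root ∈ Q.asIdeal) :
    Q ∈ Set.range (H.factorDivisor hp) := by
  obtain ⟨p, hpp, hpg, hle⟩ :=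
    H.exists_span_root_le (Finset.prod_ne_zero_iff.2 fun i _ => (hp i).ne_zero) hQ
  obtain ⟨i, -, hi⟩ := (Prime.dvd_finsetProd_iff hpp h).1 hpg
  have hpQ : algebraMap A B p ∈ Q.asIdeal := hle (Ideal.subset_span (Set.mem_insert_of_mem _ rfl))
  exact ⟨i, (H.eq_rootDivisor _ (hp i) _ (Ideal.mem_of_dvd _ (_root_.map_dvd _ hi) hpQ)).symm⟩

theorem closure_range_toClass_factorDivisor (hg : ∏ i, h i ∈ 𝒜 m) (hmn : m.Coprime n) :
    AddSubgroup.closure (Set.range fun i => (H.factorDivisor hp i).toClass) = ⊤ :=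
  H.eq_top_of_forall_root_mem hg hmn fun Q hQ => by
    obtain ⟨i, rfl⟩ := H.mem_range_factorDivisor hp hQ
    exact AddSubgroup.subset_closure (Set.mem_range_self i)

variable (hsq : Squarefree (∏ i, h i))

include hsq

theorem factorDivisor_injective : Function.Injective (H.factorDivisor hp) := by
  classical
  intro i j hij
  by_contra hne
  have hdvd : h j ∣ h i := by
    rw [← H.algebraMap_mem_factorDivisor hp, ← hij, H.algebraMap_mem_factorDivisor hp]
  refine (hp j).not_isUnit (hsq (h j) ((mul_dvd_mul_right hdvd _).trans ?_))
  rw [← Finset.mul_prod_erase Finset.univ h (Finset.mem_univ i)]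
  exact mul_dvd_mul_left _ (Finset.dvd_prod_of_mem h (by simp [Ne.symm hne]))

theorem ord_root_factorDivisor (i : ι) : (H.factorDivisor hp i).ord H.root = 1 :=
  H.ord_root_rootDivisor _ (hp i) _ hsq

theorem sum_toClass_factorDivisor : ∑ i, (H.factorDivisor hp i).toClass = 0 := by
  have hsum := PrimeDivisor.sum_ord_smul_toClass_eq_zero (H.factorDivisor_injective hp hsq)
    (H.root_ne_zero hsq.ne_zero) fun Q => H.mem_range_factorDivisor hp
  simpa only [H.ord_root_factorDivisor hp hsq, one_smul] using hsum

variable [IsIntegrallyClosed B]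

theorem isHomogeneousElem_of_forall_ord_eq_zero (hg : ∏ i, h i ∈ 𝒜 m) {u : B} (hu : u ≠ 0)
    (hord : ∀ Q ∉ Set.range (H.factorDivisor hp), Q.ord u = 0) :
    SetLike.IsHomogeneousElem (weightSpace (H.coaction hg)) u := by
  have hroot := H.root_ne_zero hsq.ne_zero
  have hdvd : u ∣ H.root ^ ∑ i, (H.factorDivisor hp i).ord u := by
    refine PrimeDivisor.dvd_of_forall_ord_le (pow_ne_zero _ hroot) hu fun Q => ?_
    by_cases hQ : Q ∈ Set.range (H.factorDivisor hp)
    · obtain ⟨i, rfl⟩ := hQ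
      rw [PrimeDivisor.ord_pow _ hroot, H.ord_root_factorDivisor hp hsq, mul_one]
      exact Finset.single_le_sum (f := fun i => (H.factorDivisor hp i).ord u)
        (fun _ _ => Nat.zero_le _) (Finset.mem_univ i)
    · rw [hord Q hQ]
      exact Nat.zero_le _
  exact isHomogeneousElem_of_dvd _ ⟨_, H.root_pow_mem hg _⟩ (pow_ne_zero _ hroot) hdvd

theorem exists_modEq_of_sum_smul_toClass_eq_zero (hg : ∏ i, h i ∈ 𝒜 m) (hmn : m.Coprime n)
    {c : ι → ℕ} (hc : ∑ i, c i • (H.factorDivisor hp i).toClass = 0) :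
    ∃ t, ∀ i, c i ≡ t [MOD n] := by
  obtain ⟨u, hu, hord, hord'⟩ := PrimeDivisor.exists_ord_eq_of_sum_smul_toClass_eq_zero
    (H.factorDivisor_injective hp hsq) hc
  obtain ⟨a, t, -, rfl⟩ := H.exists_eq_algebraMap_mul_root_pow hg hmn
    (H.isHomogeneousElem_of_forall_ord_eq_zero hp hsq hg hu hord')
  have hroot := H.root_ne_zero hsq.ne_zero
  have ha : a ≠ 0 := by
    rintro rfl
    simp at hu
  refine ⟨t, fun i => ?_⟩
  obtain ⟨b, hb⟩ : n ∣ (H.factorDivisor hp i).ord (algebraMap A B a) :=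
    H.dvd_ord_algebraMap_rootDivisor _ (hp i) _ hsq ha
  rw [← hord i, PrimeDivisor.ord_mul _ (H.algebraMap_ne_zero ha) (pow_ne_zero _ hroot), hb,
    PrimeDivisor.ord_pow _ hroot, H.ord_root_factorDivisor hp hsq, mul_one, Nat.ModEq,
    Nat.mul_add_mod]

end FactorDivisor

end CyclicCover

section FinCastSucc

variable {M : Type*} [AddCommGroup M] {s : ℕ} {v : Fin (s + 1) → M}

theorem closure_range_castSucc (hsum : ∑ i, v i = 0) :
    AddSubgroup.closure (Set.range fun i : Fin s => v i.castSucc) =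
      AddSubgroup.closure (Set.range v) := by
  refine le_antisymm (AddSubgroup.closure_mono (Set.range_comp_subset_range Fin.castSucc v)) ?_
  rw [AddSubgroup.closure_le]
  rintro _ ⟨i, rfl⟩
  have hmem (i : Fin s) :
      v i.castSucc ∈ AddSubgroup.closure (Set.range fun i : Fin s => v i.castSucc) :=
    AddSubgroup.subset_closure (Set.mem_range_self i)
  induction i using Fin.lastCases with
  | cast i => exact hmem i
  | last =>
    rw [Fin.sum_univ_castSucc] at hsum
    rw [eq_neg_of_add_eq_zero_right hsum]
    exact neg_mem (sum_mem fun i _ => hmem i)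

theorem linearIndependent_castSucc {n : ℕ} [NeZero n] [Module (ZMod n) M]
    (hv : ∀ c : Fin (s + 1) → ℕ, ∑ i, c i • v i = 0 → ∃ t, ∀ i, c i ≡ t [MOD n]) :
    LinearIndependent (ZMod n) fun i : Fin s => v i.castSucc := by
  refine Fintype.linearIndependent_iff.2 fun x hx i => ?_
  obtain ⟨t, ht⟩ := hv (Fin.snoc (fun i => (x i).val) 0) <| by
    rw [Fin.sum_univ_castSucc, ← hx]
    simp [← Nat.cast_smul_eq_nsmul (ZMod n)]
  have hmod := (ht i.castSucc).trans (ht (Fin.last s)).symm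
  rw [Fin.snoc_castSucc, Fin.snoc_last, ← ZMod.natCast_eq_natCast_iff] at hmod
  simpa using hmod

end FinCastSucc

section Span

variable {R M : Type*} [Ring R] [AddCommGroup M] [Module R M]

theorem span_eq_top_of_closure_eq_top {X : Set M} (hX : AddSubgroup.closure X = ⊤) :
    Submodule.span R X = ⊤ := by
  have hle : AddSubgroup.closure X ≤ (Submodule.span R X).toAddSubgroup :=
    (AddSubgroup.closure_le _).2 Submodule.subset_span
  exact eq_top_iff.2 fun x _ => hle (hX ▸ AddSubgroup.mem_top x)

theorem closure_image_ne_top_of_linearIndependent [Nontrivial R] {ι : Type*} {v : ι → M}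
    (hv : LinearIndependent R v) {J : Set ι} (hJ : J ≠ Set.univ) :
    AddSubgroup.closure (v '' J) ≠ ⊤ := by
  obtain ⟨j, hj⟩ := (Set.ne_univ_iff_exists_notMem J).1 hJ
  intro htop
  have hspan : Submodule.span R (v '' J) = ⊤ := span_eq_top_of_closure_eq_top htop
  exact hv.notMem_span_image hj (hspan ▸ Submodule.mem_top)

end Span

theorem one_notMem_of_coprime {A σ : Type*} [Semiring A] [Nontrivial A] [SetLike σ A]
    [AddSubmonoidClass σ A] (𝒜 : ℕ → σ) [GradedRing 𝒜] {m n : ℕ} (hn : n ≠ 1)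
    (hmn : m.Coprime n) : (1 : A) ∉ 𝒜 m := by
  intro hm
  obtain rfl := DirectSum.degree_eq_of_mem_mem 𝒜 hm SetLike.GradedOne.one_mem one_ne_zero
  exact hn ((Nat.coprime_zero_left n).1 hmn)

theorem proposition3p1_general {A B σ : Type*} [CommRing A] [IsDomain A]
    [UniqueFactorizationMonoid A] [CommRing B] [IsDomain B] [IsNoetherianRing B]
    [IsIntegrallyClosed B] [Algebra A B] {n : ℕ} {g : A} (H : CyclicCover B n g)
    [SetLike σ A] [AddSubmonoidClass σ A] (𝒜 : ℕ → σ) [GradedRing 𝒜] {m : ℕ} (hg : g ∈ 𝒜 m)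
    (hmn : m.Coprime n) {r : ℕ} (h : Fin r → A) (hirr : ∀ i, Irreducible (h i))
    (hprod : g = ∏ i, h i) :
    Nonempty (DivisorClassGroup B ≃+ (Fin (r - 1) → ZMod n)) ∧
    ∃ P : Fin r → PrimeDivisor B,
      (∀ i, (P i).asIdeal = Ideal.span {H.root, algebraMap A B (h i)}) ∧
      AddSubgroup.closure
        (Set.range fun i : Fin (r - 1) => (P (i.castLE (Nat.sub_le r 1))).toClass) = ⊤ ∧
      (2 ≤ n → ∀ J : Set (Fin (r - 1)), J ≠ Set.univ →
        AddSubgroup.closure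
          ((fun i : Fin (r - 1) => (P (i.castLE (Nat.sub_le r 1))).toClass) '' J) ≠ ⊤) := by
  subst hprod
  have hp (i : Fin r) : Prime (h i) := (hirr i).prime
  have hg0 : ∏ i, h i ≠ 0 := Finset.prod_ne_zero_iff.2 fun i _ => (hp i).ne_zero
  have htorsion := H.nsmul_divisorClassGroup hg0 hg hmn
  obtain rfl | hn : n = 1 ∨ 2 ≤ n := by have := H.ne_zero; omega
  · have : Subsingleton (DivisorClassGroup B) :=
      subsingleton_of_forall_eq 0 fun x => by simpa using htorsion x
    let e := AddEquiv.ofBijective (0 : DivisorClassGroup B →+ (Fin (r - 1) → ZMod 1))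
      ⟨Function.injective_of_subsingleton _, Function.surjective_to_subsingleton _⟩
    exact ⟨⟨e⟩, H.factorDivisor hp, fun _ => rfl, Subsingleton.elim _ _,
      fun h => absurd h (by decide)⟩
  obtain _ | s := r
  · exact absurd (by simpa using hg) (one_notMem_of_coprime 𝒜 (by omega) hmn)
  have : NeZero n := ⟨H.ne_zero⟩
  have : Fact (1 < n) := ⟨hn⟩
  let := AddCommGroup.zmodModule htorsion
  have hsq := H.squarefree hn
  have hli := linearIndependent_castSucc fun _ =>
    H.exists_modEq_of_sum_smul_toClass_eq_zero hp hsq hg hmn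
  have hgen := (closure_range_castSucc (H.sum_toClass_factorDivisor hp hsq)).trans
    (H.closure_range_toClass_factorDivisor hp hg hmn)
  let basis := Module.Basis.mk hli (span_eq_top_of_closure_eq_top hgen).ge
  exact ⟨⟨basis.equivFun.toAddEquiv⟩, H.factorDivisor hp, fun _ => rfl, hgen,
    fun _ _ hJ => closure_image_ne_top_of_linearIndependent hli hJ⟩

/-- The defining presentation of `k[z, x₁, …, x_d] / (zⁿ - g)`. -/
noncomputable def Hypersurface.cyclicCover {k : Type*} [Field k] {d n : ℕ} (hn : 1 ≤ n)
    (g : MvPolynomial (Fin d) k) : CyclicCover (Hypersurface n g) n g where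
  map := Ideal.Quotient.mkₐ (MvPolynomial (Fin d) k) _
  map_surjective := Ideal.Quotient.mkₐ_surjective _ _
  ker_map := Ideal.Quotient.mkₐ_ker (MvPolynomial (Fin d) k) _
  monic := Polynomial.monic_X_pow_sub_C g (Nat.one_le_iff_ne_zero.1 hn)

theorem proposition3p1 {k : Type*} [Field k] {d : ℕ} (n : ℕ) (hn : 1 ≤ n)
    (g : MvPolynomial (Fin d) k)
    -- `R = k[z, x₁, …, x_d] / (zⁿ - g)` is a normal domain
    [IsDomain (Hypersurface n g)] [IsIntegrallyClosed (Hypersurface n g)]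
    -- an `ℕ`-grading on `A = k[x₁, …, x_d]` with `A₀ = k`
    (𝒜 : ℕ → Submodule k (MvPolynomial (Fin d) k)) [GradedAlgebra 𝒜]
    (h𝒜 : 𝒜 0 = LinearMap.range (Algebra.linearMap k (MvPolynomial (Fin d) k)))
    -- `g` is homogeneous of degree `m` coprime to `n`
    (m : ℕ) (hg : g ∈ 𝒜 m) (hmn : Nat.Coprime m n)
    -- the factorization `g = h₁ ⋯ h_r`
    (r : ℕ) (h : Fin r → MvPolynomial (Fin d) k) (hirr : ∀ i, Irreducible (h i))
    (hprod : g = ∏ i, h i) :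
    Nonempty (DivisorClassGroup (Hypersurface n g) ≃+ (Fin (r - 1) → ZMod n)) ∧
    ∃ P : Fin r → PrimeDivisor (Hypersurface n g),
      (∀ i, (P i).asIdeal = Ideal.span {Hypersurface.z n g, Hypersurface.of n g (h i)}) ∧
      -- the classes of the first `r - 1` of these primes generate `Cl(R)`
      AddSubgroup.closure
        (Set.range fun i : Fin (r - 1) => (P (i.castLE (Nat.sub_le r 1))).toClass) = ⊤ ∧
      -- and, for `n ≥ 2`, no proper subfamily does
      (2 ≤ n → ∀ J : Set (Fin (r - 1)), J ≠ Set.univ →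
        AddSubgroup.closure
          ((fun i : Fin (r - 1) => (P (i.castLE (Nat.sub_le r 1))).toClass) '' J) ≠ ⊤) := by
  exact proposition3p1_general (Hypersurface.cyclicCover hn g) 𝒜 hg hmn h hirr hprod
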